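/- Let $k:\mathbb{N}\to\mathbb{N}$ satisfy $k(n)=O(\log n)$, and let $f=(f_n)_{n\in\mathbb{N}}$ be a family of functions $f_n:\{0,1\}^n\times\{0,1\}^n\to\{0,1\}^{k(n)}$ that is log-space computable: there is a single deterministic Turing machine, with a two-way read-only input tape, a work tape and a write-only output tape, that for all $n$ and $x,y\in\{0,1\}^n$, on input the concatenation $xy$, halts with $f_n(x,y)$ on its output tape after visiting at most $O(\log n)$ work-tape cells. A garden-hose protocol with $s$ pipes for inputs in $\{0,1\}^n\times\{0,1\}^n$ consists of the following: $s$ pipes run between Alice and Bob; depending only on $x$, Alice links some of the pipe ends on her side one-to-one (in pairs) with hoses and connects a water tap to one of her remaining pipe ends; depending only on $y$, Bob links some of the pipe ends on his side one-to-one with hoses. The water runs from the tap through pipes and hoses until it reaches a pipe end to which nothing is connected, where it exits. Then there is a polynomial $q$ such that for every $n$ there are a garden-hose protocol with $s\le q(n)$ pipes and pairwise distinct pipes $p_w$, one for each label $w\in\{0,1\}^{k(n)}$ and chosen independently of the inputs, such that for all $x,y\in\{0,1\}^n$ the water exits on Alice's side at the pipe $p_{f_n(x,y)}$. -/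

import Mathlib

/-! ## Deterministic space-bounded Turing machines with output -/

/-- What an input head can see: an end marker or an input bit. -/
inductive InputSymbol
  | leftEnd
  | bit (b : Bool)
  | rightEnd

/-- Movement of a head by at most one cell. -/
inductive HeadMove
  | left
  | stay
  | right

/-- The action of a machine in one step: the new state, the symbol written on the scanned work-tape
cell, the movements of the two heads, and possibly one bit appended to the output tape. -/
structure TMAction (Q Γ : Type) where
  state : Q
  write : Γ
  moveInput : HeadMove
  moveWork : HeadMove
  emit : Option Bool

/-- A deterministic Turing machine with a two-way read-only input tape (with end markers), a one-way
infinite read-write work tape and a write-only, left-to-right output tape. It halts when the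
transition function returns `none`. -/
structure LogTM where
  Q : Type
  Γ : Type
  finiteQ : Finite Q
  finiteΓ : Finite Γ
  start : Q
  blank : Γ
  trans : Q → InputSymbol → Γ → Option (TMAction Q Γ)

namespace LogTM

/-- Configurations. Input position `0` is the left marker, positions `1, …, N` hold the input bits,
and position `N + 1` is the right marker. -/
structure Cfg (M : LogTM) where
  state : M.Q
  inputPos : ℕ
  work : ℕ → M.Γ
  workPos : ℕ
  output : List Bool

/-- The symbol at position `i` of the input tape holding `w`. -/
def readInput (w : List Bool) : ℕ → InputSymbol
  | 0 => .leftEnd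
  | i + 1 => match w[i]? with
    | some b => .bit b
    | none => .rightEnd

/-- The input head cannot leave the marked part of the tape. -/
def moveInputPos (N : ℕ) : HeadMove → ℕ → ℕ
  | .left, i => i - 1
  | .stay, i => i
  | .right, i => min (i + 1) (N + 1)

/-- The work head stays put when told to move left from the leftmost cell. -/
def moveWorkPos : HeadMove → ℕ → ℕ
  | .left, i => i - 1
  | .stay, i => i
  | .right, i => i + 1

/-- The initial configuration. -/
def init (M : LogTM) : M.Cfg where
  state := M.start
  inputPos := 0
  work := fun _ => M.blank
  workPos := 0
  output := []

/-- One step on input `w`; `none` if the machine has halted. -/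
def step (M : LogTM) (w : List Bool) (c : M.Cfg) : Option M.Cfg :=
  (M.trans c.state (readInput w c.inputPos) (c.work c.workPos)).map fun a =>
    { state := a.state
      inputPos := moveInputPos w.length a.moveInput c.inputPos
      work := Function.update c.work c.workPos a.write
      workPos := moveWorkPos a.moveWork c.workPos
      output := c.output ++ a.emit.toList }

/-- `M`, started on input `w`, reaches the configuration `c`. -/
def Reaches (M : LogTM) (w : List Bool) (c : M.Cfg) : Prop :=
  Relation.ReflTransGen (fun c₁ c₂ => M.step w c₁ = some c₂) M.init c

/-- On input `w`, the machine halts with `v` on its output tape. -/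
def HaltsWith (M : LogTM) (w v : List Bool) : Prop :=
  ∃ c : M.Cfg, M.Reaches w c ∧ M.step w c = none ∧ c.output = v

/-- On input `w`, the machine visits at most the first `s` cells of its work tape. -/
def UsesSpace (M : LogTM) (w : List Bool) (s : ℕ) : Prop :=
  ∀ c : M.Cfg, M.Reaches w c → c.workPos < s

end LogTM

/-- A family `f n : {0,1}ⁿ × {0,1}ⁿ → {0,1}^(k n)` is log-space computable: one machine, given the
concatenation of `x` and `y`, outputs `f n x y` and visits `O(log n)` work-tape cells. -/
def LogSpaceComputable (k : ℕ → ℕ)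
    (f : (n : ℕ) → (Fin n → Bool) → (Fin n → Bool) → (Fin (k n) → Bool)) : Prop :=
  ∃ (M : LogTM) (s : ℕ → ℕ),
    (fun n => (s n : ℝ)) =O[Filter.atTop] (fun n : ℕ => Real.log n) ∧
    ∀ (n : ℕ) (x y : Fin n → Bool),
      M.HaltsWith (List.ofFn x ++ List.ofFn y) (List.ofFn (f n x y)) ∧
      M.UsesSpace (List.ofFn x ++ List.ofFn y) (s n)

/-! ## The garden-hose model -/

/-- A garden-hose protocol with `s` pipes for inputs in `{0,1}ⁿ × {0,1}ⁿ`. Each player links pipe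
ends on their own side one-to-one with hoses, depending only on their own input. The hoses of a
player are given by an involution of the pipes: two distinct pipes that are swapped are joined by a
hose, and a fixed pipe has no hose. Alice connects the water tap to a pipe without a hose. -/
structure GardenHoseProtocol (n s : ℕ) where
  tap : (Fin n → Bool) → Fin s
  alice : (Fin n → Bool) → Fin s → Fin s
  bob : (Fin n → Bool) → Fin s → Fin s
  alice_involutive : ∀ x, Function.Involutive (alice x)
  bob_involutive : ∀ y, Function.Involutive (bob y)
  tap_free : ∀ x, alice x (tap x) = tap x

namespace GardenHoseProtocol

/-- The two sides of the pipes. -/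
inductive Side
  | alice
  | bob

variable {n s : ℕ}

/-- `P.Arrives x y t p`: on inputs `x`, `y` the water, having run through the pipe `p`, arrives at
the end of `p` on side `t`. -/
inductive Arrives (P : GardenHoseProtocol n s) (x y : Fin n → Bool) : Side → Fin s → Prop
  | tap : Arrives P x y Side.bob (P.tap x)
  | bobHose (p : Fin s) : Arrives P x y Side.bob p → P.bob y p ≠ p →
      Arrives P x y Side.alice (P.bob y p)
  | aliceHose (p : Fin s) : Arrives P x y Side.alice p → P.alice x p ≠ p →
      Arrives P x y Side.bob (P.alice x p)

/-- On inputs `x`, `y` the water exits on Alice's side at pipe `p`. -/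
def ExitsAtAlice (P : GardenHoseProtocol n s) (x y : Fin n → Bool) (p : Fin s) : Prop :=
  P.Arrives x y Side.alice p ∧ P.alice x p = p ∧ p ≠ P.tap x

end GardenHoseProtocol

/-! Alice and Bob can run the machine jointly by passing its configuration back and forth, each
acting only when the input head is on their own part. The difficulty is that hoses are reversible,
whereas a deterministic step may merge several configurations.

The remedy is to make the water trace an Euler tour. The nodes are pairs of a time and a state, each
with an edge to its successor, so they form a forest directed towards the final time. On first
reaching a node on the computation path, the water tours the subtrees of the later potential
predecessors before moving on. The start does not lie in these subtrees, so the tour of each must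
return (`arrives_explore`). Hence the water climbs the path and exits at the final state
(`arrives_trace`).

Space and output length are logarithmic, so there are only polynomially many configurations `R`.
Each pair of rounds advances the machine by at least one step until it halts, so `R` pairs suffice.
The last move erases everything but the output, so that the exit pipe depends on the value alone. -/

/-! ## From layered programs to garden-hose protocols -/

namespace HoseNetwork

variable {m : ℕ}

/-- A pipe `(t, u, v, d)` belongs to the potential transition from `u` at time `t` to `v` at time
`t + 1`. With `d = false` it asks whether the transition is taken, with `d = true` it carries the
answer. -/
abbrev Pipe (m : ℕ) : Type := ℕ × Fin (m + 1) × Fin (m + 1) × Bool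

/-- The first (`d = false`) or last (`d = true`) potential predecessor. -/
def extremal (m : ℕ) (d : Bool) : Fin (m + 1) := bif d then Fin.last m else 0

/-- The next potential predecessor in direction `d`. -/
def shift (d : Bool) (u : Fin (m + 1)) : Fin (m + 1) := bif d then u + 1 else u - 1

/-- The hoses of the player who moves at the times of parity `b` by the transition functions `g`.
Together the hoses of the two players trace an Euler tour around the forest of all computations. -/
def hoseLink (L : ℕ) (start : Fin (m + 1)) (b : Bool) (g : ℕ → Fin (m + 1) → Fin (m + 1)) :
    Pipe m → Pipe m
  | (t, u, v, d) =>
    if t.bodd = b then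
      if g t u = v then
        match t with
        -- Leaves of the forest send the water back. Only the start keeps free ends, and the one
        -- with `d = true` takes the tap.
        | 0 => if u = start then (0, u, v, d) else (0, u, v, !d)
        | t + 1 => (t, extremal m d, u, d)
      else (t, u, v, !d)
    else
      if u = extremal m d then
        if t + 1 < L then (t + 1, v, g (t + 1) v, d) else (t, u, v, d)
      else (t, shift d u, v, !d)

lemma shift_ne_extremal {d : Bool} {u : Fin (m + 1)} (h : u ≠ extremal m d) :
    shift d u ≠ extremal m (!d) := by
  cases d
  · simp only [extremal, shift, cond_false, Bool.not_false, cond_true] at h ⊢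
    intro h'
    apply h
    rw [sub_eq_iff_eq_add] at h'
    simpa using h'
  · simp only [extremal, shift, cond_false, Bool.not_true, cond_true] at h ⊢
    intro h'
    apply h
    have : u + 1 = Fin.last m + 1 := by simpa using h'
    exact add_right_cancel this

lemma shift_shift (d : Bool) (u : Fin (m + 1)) : shift (!d) (shift d u) = u := by
  cases d <;> simp [shift]

/-- The bound on the time is needed because a hose from time `t + 1` down to time `t` is undone by
one going up, which exists only if `t + 1 < L`. -/
lemma hoseLink_involutive (L : ℕ) (start : Fin (m + 1)) (b : Bool)
    (g : ℕ → Fin (m + 1) → Fin (m + 1)) {p : Pipe m} (hp : p.1 < L) :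
    hoseLink L start b g (hoseLink L start b g p) = p := by
  obtain ⟨t, u, v, d⟩ := p
  by_cases hb : t.bodd = b
  · by_cases hg : g t u = v
    · cases t with
      | zero => by_cases hu : u = start <;> simp_all [hoseLink]
      | succ t =>
        have : t.bodd ≠ b := by rintro rfl; simp at hb
        simp_all [hoseLink]
    · simp [hoseLink, hb, hg]
  · have hb' : (t + 1).bodd = b := by revert hb; cases h : t.bodd <;> cases b <;> simp [h]
    by_cases hu : u = extremal m d
    · by_cases ht : t + 1 < L
      · simp only [hoseLink, hb, hu, ht, hb', if_true, if_false]
      · simp [hoseLink, hb, hu, ht]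
    · simp [hoseLink, hb, hu, shift_ne_extremal hu, shift_shift]

lemma hoseLink_lt (L : ℕ) (start : Fin (m + 1)) (b : Bool)
    (g : ℕ → Fin (m + 1) → Fin (m + 1)) {p : Pipe m} (hp : p.1 < L) :
    (hoseLink L start b g p).1 < L := by
  obtain ⟨t, u, v, d⟩ := p
  cases t with
  | zero => simp only [hoseLink]; split_ifs <;> simp_all
  | succ t => simp only [hoseLink]; split_ifs; all_goals simp_all <;> omega

/-! ### The course of the water -/

/-- The state at time `t` when the two players move alternately, by `gs false` at even and by
`gs true` at odd times. -/
def trace {C : Type*} (gs : Bool → ℕ → C → C) (start : C) : ℕ → C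
  | 0 => start
  | t + 1 => gs t.bodd t (trace gs start t)

/-- `Arr b p`, read as "the water arrives through `p` at player `b`", is closed under the hoses. -/
def FlowClosed (L : ℕ) (start : Fin (m + 1)) (gs : Bool → ℕ → Fin (m + 1) → Fin (m + 1))
    (Arr : Bool → Pipe m → Prop) : Prop :=
  ∀ b p, p.1 < L → Arr b p → hoseLink L start b (gs b) p ≠ p →
    Arr (!b) (hoseLink L start b (gs b) p)

variable {L : ℕ} {start : Fin (m + 1)} {gs : Bool → ℕ → Fin (m + 1) → Fin (m + 1)}
  {Arr : Bool → Pipe m → Prop}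

/-- If all later potential predecessors `j` of `v` are explored and left, the water that comes back
from the predecessor `i` comes back from the last one. -/
lemma arrives_last (hop : FlowClosed L start gs Arr) {t : ℕ} (ht : t < L) {i v : Fin (m + 1)}
    (explore : ∀ j, i < j → Arr t.bodd (t, j, v, false) → Arr (!t.bodd) (t, j, v, true))
    (h : Arr (!t.bodd) (t, i, v, true)) : Arr (!t.bodd) (t, Fin.last m, v, true) := by
  suffices ∀ j : ℕ, (i : ℕ) ≤ j → ∀ hj : j < m + 1, Arr (!t.bodd) (t, ⟨j, hj⟩, v, true) from
    this m (by omega) (by omega)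
  intro j hij
  induction j, hij using Nat.le_induction with
  | base => exact fun _ => h
  | succ j hij ih =>
    intro hj
    have hne : (⟨j, by omega⟩ : Fin (m + 1)) ≠ Fin.last m := by
      simp only [ne_eq, Fin.ext_iff, Fin.val_last]; omega
    have hadd : (⟨j, by omega⟩ : Fin (m + 1)) + 1 = ⟨j + 1, hj⟩ := by
      rw [Fin.ext_iff, Fin.val_add_one_of_lt (Fin.lt_last_iff_ne_last.2 hne)]
    have := hop _ _ ht (ih (by omega))
    rw [show hoseLink L start (!t.bodd) (gs !t.bodd) (t, ⟨j, by omega⟩, v, true)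
      = (t, ⟨j + 1, hj⟩, v, false) by simp [hoseLink, extremal, shift, hne, hadd],
      Bool.not_not] at this
    exact explore _ (Fin.lt_def.2 (by simp; omega)) (this (by simp))

/-- Water that asks for a transition off the computation path comes back with the answer. -/
lemma arrives_explore (hop : FlowClosed L start gs Arr) {t : ℕ} (ht : t < L)
    {u v : Fin (m + 1)} (huv : u ≠ trace gs start t ∨ gs t.bodd t u ≠ v)
    (h : Arr t.bodd (t, u, v, false)) : Arr (!t.bodd) (t, u, v, true) := by
  induction t generalizing u v with
  | zero =>
    have := hop _ _ ht h
    by_cases hg : gs (Nat.bodd 0) 0 u = v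
    · have hu : u ≠ start := huv.resolve_right (not_not.2 hg)
      rw [show hoseLink L start (Nat.bodd 0) (gs (Nat.bodd 0)) (0, u, v, false)
        = (0, u, v, true) by simp only [hoseLink, hg, hu, if_true, if_false, Bool.not_false]]
        at this
      exact this (by simp)
    · rw [show hoseLink L start (Nat.bodd 0) (gs (Nat.bodd 0)) (0, u, v, false)
        = (0, u, v, true) by simp only [hoseLink, hg, if_true, if_false, Bool.not_false]] at this
      exact this (by simp)
  | succ t ih =>
    have down := hop _ _ ht h
    by_cases hg : gs (t + 1).bodd (t + 1) u = v
    · have hu : u ≠ trace gs start (t + 1) := huv.resolve_right (not_not.2 hg)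
      have explore (j : Fin (m + 1)) := ih (u := j) (v := u) (by omega) (by
        -- If the transition from `j` to `u` were on the path, then `u` would be on it too.
        by_contra! hc
        exact hu (by rw [trace, ← hc.1, hc.2]))
      rw [show hoseLink L start (t + 1).bodd (gs (t + 1).bodd) (t + 1, u, v, false)
        = (t, 0, u, false) by simp only [hoseLink, hg, if_true, extremal, cond_false],
        show (!(t + 1).bodd) = t.bodd by simp] at down
      have up := hop _ _ (by simp; omega) (arrives_last hop (by omega) (fun j _ => explore j)
        (explore 0 (down (by simp))))
      rw [show hoseLink L start (!t.bodd) (gs !t.bodd) (t, Fin.last m, u, true)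
        = (t + 1, u, v, true) by
          simp only [Nat.bodd_succ] at hg
          simp [hoseLink, extremal, hg, ht]] at up
      simpa using up (by simp)
    · rw [show hoseLink L start (t + 1).bodd (gs (t + 1).bodd) (t + 1, u, v, false)
        = (t + 1, u, v, true) by simp only [hoseLink, hg, if_true, if_false, Bool.not_false]]
        at down
      exact down (by simp)

/-- The water follows the computation path. -/
lemma arrives_trace (hop : FlowClosed L start gs Arr)
    (tap : Arr true (0, start, gs false 0 start, true)) {t : ℕ} (ht : t < L) :
    Arr (!t.bodd) (t, Fin.last m, trace gs start (t + 1), true) := by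
  have finish {t : ℕ} (ht : t < L)
      (h : Arr (!t.bodd) (t, trace gs start t, trace gs start (t + 1), true)) :
      Arr (!t.bodd) (t, Fin.last m, trace gs start (t + 1), true) :=
    -- The tour resumes just after the path's own predecessor, so all predecessors still to be
    -- explored are off the path.
    arrives_last hop ht (fun j hj => arrives_explore hop ht (Or.inl hj.ne')) h
  induction t with
  | zero => exact finish ht tap
  | succ t ih =>
    apply finish ht
    have := hop _ _ (by simp; omega) (ih (by omega))
    rw [show hoseLink L start (!t.bodd) (gs !t.bodd)
        (t, Fin.last m, trace gs start (t + 1), true)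
      = (t + 1, trace gs start (t + 1), trace gs start (t + 2), true) by
        simp [hoseLink, extremal, ht, trace]] at this
    simpa using this (by simp)

end HoseNetwork

/-! ### The protocol of a layered program -/

open HoseNetwork in
/-- Two players who alternately transform a state in `Fin (m + 1)`, for `2 * T + 2` rounds, can be
replaced by a garden-hose protocol in which the water exits at a pipe that tells the final state. -/
theorem GardenHoseProtocol.exists_of_layered {n m : ℕ} (T : ℕ)
    (gx gy : (Fin n → Bool) → ℕ → Fin (m + 1) → Fin (m + 1)) (start : Fin (m + 1)) :
    ∃ (P : GardenHoseProtocol n ((2 * T + 2) * ((m + 1) * ((m + 1) * 2))))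
      (pipe : Fin (m + 1) ↪ Fin ((2 * T + 2) * ((m + 1) * ((m + 1) * 2)))),
      ∀ x y, P.ExitsAtAlice x y
        (pipe (trace (fun b => bif b then gy y else gx x) start (2 * T + 2))) := by
  -- The number of rounds is even, so Bob moves last and the final answer arrives on Alice's side.
  set L := 2 * T + 2 with hL
  let e : {p : Pipe m // p.1 < L} ≃ Fin (L * ((m + 1) * ((m + 1) * 2))) :=
    Equiv.trans (β := Fin L × Fin (m + 1) × Fin (m + 1) × Bool)
      ⟨fun p => (⟨p.1.1, p.2⟩, p.1.2), fun p => ⟨(p.1, p.2), p.1.2⟩, fun _ => rfl, fun _ => rfl⟩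
      (Fintype.equivFinOfCardEq (by simp))
  let hose (b : Bool) (g : ℕ → Fin (m + 1) → Fin (m + 1)) (i : Fin _) : Fin _ :=
    e ⟨hoseLink L start b g (e.symm i).1, hoseLink_lt L start b g (e.symm i).2⟩
  have hose_apply (b g) (p : Pipe m) (hp : p.1 < L) :
      hose b g (e ⟨p, hp⟩) = e ⟨hoseLink L start b g p, hoseLink_lt L start b g hp⟩ := by
    simp only [hose, Equiv.symm_apply_apply]
  have hose_involutive (b g) : Function.Involutive (hose b g) := by
    intro i
    obtain ⟨⟨p, hp⟩, rfl⟩ := e.surjective i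
    simp only [hose_apply, hoseLink_involutive L start b g hp]
  let P : GardenHoseProtocol n (L * ((m + 1) * ((m + 1) * 2))) :=
    { tap := fun x => e ⟨(0, start, gx x 0 start, true), by simp [hL]⟩
      alice := fun x => hose false (gx x)
      bob := fun y => hose true (gy y)
      alice_involutive := fun x => hose_involutive _ _
      bob_involutive := fun y => hose_involutive _ _
      tap_free := fun x => by
        rw [hose_apply]
        simp [hoseLink] }
  let pipe : Fin (m + 1) ↪ Fin (L * ((m + 1) * ((m + 1) * 2))) :=
    ⟨fun v => e ⟨(2 * T + 1, Fin.last m, v, true), by simp [hL]⟩, fun v w h => by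
      simpa using h⟩
  refine ⟨P, pipe, fun x y => ?_⟩
  let gs : Bool → ℕ → Fin (m + 1) → Fin (m + 1) := fun b => bif b then gy y else gx x
  let Arr : Bool → Pipe m → Prop := fun b p =>
    ∃ hp : p.1 < L, P.Arrives x y (bif b then Side.bob else Side.alice) (e ⟨p, hp⟩)
  have hop : FlowClosed L start gs Arr := by
    rintro b p hp ⟨_, h⟩ hne
    refine ⟨hoseLink_lt _ _ _ _ hp, ?_⟩
    have hne' : hose b (gs b) (e ⟨p, hp⟩) ≠ e ⟨p, hp⟩ := by
      rw [hose_apply]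
      simpa using hne
    rw [← hose_apply b _ p hp]
    cases b
    · exact Arrives.aliceHose _ h hne'
    · exact Arrives.bobHose _ h hne'
  have hbodd : (2 * T + 1).bodd = true := by simp
  obtain ⟨hp, h⟩ := arrives_trace (t := 2 * T + 1) hop ⟨by simp [hL], Arrives.tap⟩ (by omega)
  rw [hbodd] at h
  refine ⟨h, ?_, ?_⟩
  · change hose false (gx x) (e _) = e _
    rw [hose_apply]
    congr 2
    simp [hoseLink, extremal, hL]
  · intro h
    have := congrArg Prod.fst (congrArg Subtype.val (e.injective h))
    simp at this

open HoseNetwork in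
/-- `GardenHoseProtocol.exists_of_layered` for an arbitrary finite type of states. -/
theorem GardenHoseProtocol.exists_of_layered_fintype {n : ℕ} {C : Type*} [Finite C] (T : ℕ)
    (gx gy : (Fin n → Bool) → ℕ → C → C) (start : C) :
    ∃ (P : GardenHoseProtocol n ((2 * T + 2) * (Nat.card C * (Nat.card C * 2))))
      (pipe : C ↪ Fin ((2 * T + 2) * (Nat.card C * (Nat.card C * 2)))),
      ∀ x y, P.ExitsAtAlice x y
        (pipe (trace (fun b => bif b then gy y else gx x) start (2 * T + 2))) := by
  have : Nonempty C := ⟨start⟩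
  obtain ⟨m, hm⟩ := Nat.exists_eq_succ_of_ne_zero (Nat.card_pos (α := C)).ne'
  have e : C ≃ Fin (m + 1) := Finite.equivFinOfCardEq hm
  rw [hm]
  obtain ⟨P, pipe, h⟩ := exists_of_layered T (fun x t c => e (gx x t (e.symm c)))
    (fun y t c => e (gy y t (e.symm c))) (e start)
  refine ⟨P, e.toEmbedding.trans pipe, fun x y => ?_⟩
  have htrace (t : ℕ) : e (trace (fun b => bif b then gy y else gx x) start t) =
      trace (fun b => bif b then fun t c => e (gy y t (e.symm c))
        else fun t c => e (gx x t (e.symm c))) (e start) t := by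
    induction t with
    | zero => rfl
    | succ t ih =>
      simp only [trace, ← ih]
      cases t.bodd <;> simp
  change P.ExitsAtAlice x y (pipe (e _))
  rw [htrace]
  exact h x y

/-! ## Bounded configurations -/

/-- By pigeonhole the orbit repeats within its first `s.ncard + 1` terms and is periodic from there
on. Since it eventually stays at `b`, the cycle must be `b` itself. -/
lemma Function.iterate_card_eq_of_isFixedPt {α : Type*} {F : α → α} {a b : α} {s : Set α}
    (hs : s.Finite) (hF : ∀ i, F^[i] a ∈ s) (hb : F b = b) (hab : ∃ N, F^[N] a = b) {i : ℕ}
    (hi : s.ncard ≤ i) : F^[i] a = b := by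
  have stays (j : ℕ) : F^[j] b = b := Function.iterate_fixed hb j
  obtain ⟨p, hp, q, hq, hne, heq⟩ : ∃ p ∈ Finset.range (i + 1), ∃ q ∈ Finset.range (i + 1),
      p ≠ q ∧ F^[p] a = F^[q] a := by
    apply Finset.exists_ne_map_eq_of_card_lt_of_maps_to (t := hs.toFinset)
    · rw [← Set.ncard_eq_toFinset_card s hs, Finset.card_range]; omega
    · intro j _
      simpa using hF j
  wlog hpq : p < q generalizing p q
  · exact this q hq p hp hne.symm heq.symm (by omega)
  simp only [Finset.mem_range] at hp hq
  obtain ⟨N, hN⟩ := hab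
  have period (r : ℕ) : F^[p + r * (q - p)] a = F^[p] a := by
    induction r with
    | zero => simp
    | succ r ih =>
      rw [show p + (r + 1) * (q - p) = (q - p) + (p + r * (q - p)) by ring,
        Function.iterate_add_apply, ih, ← Function.iterate_add_apply, Nat.sub_add_cancel hpq.le,
        heq]
  have hpb : F^[p] a = b := by
    have hle : N ≤ p + N * (q - p) := le_add_left (Nat.le_mul_of_pos_right N (by omega))
    rw [← period N, ← Nat.sub_add_cancel hle, Function.iterate_add_apply, hN, stays]
  rw [← Nat.sub_add_cancel (show p ≤ i by omega), Function.iterate_add_apply, hpb, stays]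

lemma exists_polynomial_pow_le {s : ℕ → ℕ}
    (hs : (fun n => (s n : ℝ)) =O[Filter.atTop] (fun n : ℕ => Real.log n)) (b : ℕ) :
    ∃ q : Polynomial ℕ, ∀ n, b ^ s n ≤ q.eval n := by
  obtain ⟨c, hc⟩ := hs.bound
  obtain ⟨N, hN⟩ := Filter.eventually_atTop.1 hc
  obtain ⟨d, hd⟩ := exists_nat_ge (b * c)
  -- The constant term covers the finitely many `n` for which the asymptotic bound may fail.
  refine ⟨Polynomial.C (∑ i ∈ Finset.range (N + 1), b ^ s i) + Polynomial.X ^ d, fun n => ?_⟩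
  simp only [Polynomial.eval_add, Polynomial.eval_C, Polynomial.eval_pow, Polynomial.eval_X]
  by_cases hn : n < N + 1
  · exact (Finset.single_le_sum (f := fun i => b ^ s i) (fun _ _ => Nat.zero_le _)
      (Finset.mem_range.2 hn)).trans (Nat.le_add_right _ _)
  · refine le_add_left ?_
    have hn0 : (0 : ℝ) < n := by exact_mod_cast (show 0 < n by omega)
    have hlog : 0 ≤ Real.log n := Real.log_natCast_nonneg n
    have h := hN n (by omega)
    rw [Real.norm_of_nonneg hlog, Real.norm_of_nonneg (Nat.cast_nonneg _)] at h
    -- Using `exp b` as the base avoids `log b` and the case `b = 0`.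
    have hb : (b : ℝ) ≤ Real.exp b := by linarith [Real.add_one_le_exp (b : ℝ)]
    suffices ((b : ℝ) ^ s n) ≤ (n : ℝ) ^ d by exact_mod_cast this
    calc (b : ℝ) ^ s n ≤ Real.exp b ^ s n := pow_le_pow_left₀ (Nat.cast_nonneg _) hb _
      _ = Real.exp (s n * b) := (Real.exp_nat_mul _ _).symm
      _ ≤ Real.exp (d * Real.log n) := Real.exp_le_exp.2 <| by
          calc (s n : ℝ) * b ≤ (c * Real.log n) * b :=
                mul_le_mul_of_nonneg_right h (Nat.cast_nonneg _)
            _ = (b * c) * Real.log n := by ring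
            _ ≤ d * Real.log n := mul_le_mul_of_nonneg_right hd hlog
      _ = (n : ℝ) ^ d := by rw [Real.exp_nat_mul, Real.exp_log hn0]

/-! ### Counting the configurations -/

namespace LogTM

variable {M : LogTM}

/-- The configurations on inputs of length `N` that use only the first `S` work-tape cells and have
written at most `K` bits. -/
def boundedCfg (M : LogTM) (N S K : ℕ) : Set M.Cfg :=
  {c | c.inputPos ≤ N + 1 ∧ c.workPos < S ∧ (∀ i, S ≤ i → c.work i = M.blank) ∧
    c.output.length ≤ K}

/-- A bounded configuration, as an element of an explicit finite type. -/
def encodeCfg (M : LogTM) (N S K : ℕ) (c : M.boundedCfg N S K) :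
    M.Q × Fin (N + 2) × (Fin S → M.Γ) × Fin S × (Fin (K + 1) → Option Bool) :=
  (c.1.state, ⟨c.1.inputPos, by have := c.2.1; omega⟩, fun i => c.1.work i,
    ⟨c.1.workPos, c.2.2.1⟩, fun i => c.1.output[(i : ℕ)]?)

lemma encodeCfg_injective (N S K : ℕ) : Function.Injective (M.encodeCfg N S K) := by
  rintro ⟨⟨q, i, w, p, o⟩, h₁, h₂, h₃, h₄⟩ ⟨⟨q', i', w', p', o'⟩, h₁', h₂', h₃', h₄'⟩ h
  simp only [encodeCfg, Prod.mk.injEq, Fin.mk.injEq] at h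
  obtain ⟨rfl, rfl, hw, rfl, ho⟩ := h
  simp only at h₃ h₃' h₄ h₄'
  obtain rfl : w = w' := by
    funext i
    by_cases hi : i < S
    · exact congrFun hw ⟨i, hi⟩
    · rw [h₃ i (by omega), h₃' i (by omega)]
  obtain rfl : o = o' := by
    apply List.ext_getElem?
    intro i
    by_cases hi : i < K + 1
    · exact congrFun ho ⟨i, hi⟩
    · rw [List.getElem?_eq_none (by omega), List.getElem?_eq_none (by omega)]
  rfl

lemma finite_boundedCfg (N S K : ℕ) : (M.boundedCfg N S K).Finite :=
  have := M.finiteQ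
  have := M.finiteΓ
  Finite.of_injective _ (encodeCfg_injective N S K)

lemma ncard_boundedCfg_le (N S K : ℕ) : (M.boundedCfg N S K).ncard ≤
    Nat.card M.Q * ((N + 2) * (Nat.card M.Γ ^ S * (2 ^ S * 3 ^ (K + 1)))) := by
  have := M.finiteQ
  have := M.finiteΓ
  refine (Nat.card_le_card_of_injective _ (encodeCfg_injective N S K)).trans ?_
  -- The head position is overestimated by a power, so that `exists_polynomial_pow_le` covers this
  -- factor too.
  have : S ≤ 2 ^ S := Nat.lt_two_pow_self.le
  simp only [Nat.card_prod, Nat.card_fun, Nat.card_eq_fintype_card (α := Fin _), Fintype.card_fin,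
    Nat.card_eq_fintype_card (α := Option Bool), Fintype.card_option, Fintype.card_bool]
  gcongr

/-- One step, where a halted machine stays as it is. -/
def run (M : LogTM) (w : List Bool) (c : M.Cfg) : M.Cfg := (M.step w c).getD c

lemma reaches_iterate_run (w : List Bool) (i : ℕ) : M.Reaches w ((M.run w)^[i] M.init) := by
  induction i with
  | zero => exact .refl
  | succ i ih =>
    rw [Function.iterate_succ_apply', run]
    cases h : M.step w ((M.run w)^[i] M.init) with
    | none => exact ih
    | some c => exact ih.tail h

lemma Reaches.exists_iterate_run {w : List Bool} {c : M.Cfg} (h : M.Reaches w c) :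
    ∃ i, (M.run w)^[i] M.init = c := by
  induction h with
  | refl => exact ⟨0, rfl⟩
  | tail _ hstep ih =>
    obtain ⟨i, rfl⟩ := ih
    exact ⟨i + 1, by rw [Function.iterate_succ_apply', run, hstep, Option.getD_some]⟩

lemma inputPos_run_le {w : List Bool} {c : M.Cfg} (h : c.inputPos ≤ w.length + 1) :
    (M.run w c).inputPos ≤ w.length + 1 := by
  unfold run step
  cases M.trans c.state (readInput w c.inputPos) (c.work c.workPos) with
  | none => exact h
  | some a =>
    simp only [Option.map_some, Option.getD_some]
    cases a.moveInput <;> simp only [moveInputPos] <;> omega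

lemma work_run {w : List Bool} {c : M.Cfg} {i : ℕ} (h : i ≠ c.workPos) :
    (M.run w c).work i = c.work i := by
  unfold run step
  cases M.trans c.state (readInput w c.inputPos) (c.work c.workPos) with
  | none => rfl
  | some a => simp [h]

lemma length_output_le_run (w : List Bool) (c : M.Cfg) :
    c.output.length ≤ (M.run w c).output.length := by
  unfold run step
  cases M.trans c.state (readInput w c.inputPos) (c.work c.workPos) with
  | none => rfl
  | some a => simp

/-- `M.run w c` depends only on the scanned input symbol. -/
lemma run_congr {w w' : List Bool} {c : M.Cfg} (hlen : w.length = w'.length)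
    (h : readInput w c.inputPos = readInput w' c.inputPos) : M.run w c = M.run w' c := by
  simp only [run, step, hlen, h]

lemma iterate_run_mem_boundedCfg {w v : List Bool} {S : ℕ} (hv : M.HaltsWith w v)
    (hS : M.UsesSpace w S) (i : ℕ) :
    (M.run w)^[i] M.init ∈ M.boundedCfg w.length S v.length := by
  refine ⟨?_, hS _ (reaches_iterate_run w i), ?_, ?_⟩
  · induction i with
    | zero => simp [init]
    | succ i ih => rw [Function.iterate_succ_apply']; exact inputPos_run_le ih
  · intro j hj
    induction i with
    | zero => rfl
    | succ i ih =>
      rw [Function.iterate_succ_apply', work_run, ih]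
      have := hS _ (reaches_iterate_run w i)
      omega
  · obtain ⟨c, hc, hhalt, rfl⟩ := hv
    obtain ⟨N, rfl⟩ := hc.exists_iterate_run
    -- Output is never erased, so its length is at most the length at halting.
    have mono : Monotone fun i => ((M.run w)^[i] M.init).output.length :=
      monotone_nat_of_le_succ fun i => by
        rw [Function.iterate_succ_apply']; exact length_output_le_run _ _
    refine (mono (Nat.le_add_left i N)).trans_eq ?_
    simp only
    rw [Nat.add_comm, Function.iterate_add_apply, Function.iterate_fixed]
    rw [run, hhalt, Option.getD_none]

end LogTM

/-! ## Splitting the computation between Alice and Bob -/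

namespace LogTM

variable {M : LogTM} {n : ℕ}

/-- Alice runs the machine for a step if its input head does not scan Bob's part of the tape. -/
def aliceStep (M : LogTM) (x : Fin n → Bool) (c : M.Cfg) : M.Cfg :=
  if c.inputPos ≤ n then M.run (List.ofFn x ++ List.replicate n false) c else c

/-- Bob runs the machine for a step if its input head does not scan Alice's part of the tape. -/
def bobStep (M : LogTM) (y : Fin n → Bool) (c : M.Cfg) : M.Cfg :=
  if c.inputPos ≤ n then c else M.run (List.replicate n false ++ List.ofFn y) c

/-- A step reads a single input symbol, so the dummy bits in place of `y` are never seen. -/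
lemma aliceStep_eq (x y : Fin n → Bool) (c : M.Cfg) :
    M.aliceStep x c = if c.inputPos ≤ n then M.run (List.ofFn x ++ List.ofFn y) c else c := by
  unfold aliceStep
  split_ifs with h
  · refine run_congr (by simp) ?_
    obtain ⟨q, i, w, p, o⟩ := c
    cases i with
    | zero => rfl
    | succ i =>
      have hi : i < n := h
      simp [readInput, List.getElem?_append_left, hi]
  · rfl

lemma bobStep_eq (x y : Fin n → Bool) (c : M.Cfg) :
    M.bobStep y c = if c.inputPos ≤ n then c else M.run (List.ofFn x ++ List.ofFn y) c := by
  unfold bobStep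
  split_ifs with h
  · rfl
  · refine run_congr (by simp) ?_
    obtain ⟨q, i, w, p, o⟩ := c
    cases i with
    | zero => exact absurd (Nat.zero_le n) h
    | succ i =>
      have hi : n ≤ i := by simp only at h; omega
      simp [readInput, List.getElem?_append_right, hi]

lemma exists_aliceStep_iterate (x y : Fin n → Bool) (i : ℕ) :
    ∃ j ≥ i, M.aliceStep x ((M.run (List.ofFn x ++ List.ofFn y))^[i] M.init)
      = (M.run (List.ofFn x ++ List.ofFn y))^[j] M.init := by
  rw [aliceStep_eq x y]
  split_ifs
  exacts [⟨i + 1, by omega, (Function.iterate_succ_apply' ..).symm⟩, ⟨i, le_rfl, rfl⟩]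

/-- Whichever part the head scans, its owner moves in this pair of rounds; both move if Alice's step
takes the head into Bob's part. -/
lemma exists_bobStep_aliceStep_iterate (x y : Fin n → Bool) (i : ℕ) :
    ∃ j ≥ i + 1,
      M.bobStep y (M.aliceStep x ((M.run (List.ofFn x ++ List.ofFn y))^[i] M.init))
        = (M.run (List.ofFn x ++ List.ofFn y))^[j] M.init := by
  rw [aliceStep_eq x y, bobStep_eq x y]
  split_ifs
  · exact ⟨i + 1, le_rfl, (Function.iterate_succ_apply' ..).symm⟩
  · exact ⟨i + 2, by omega, by simp only [Function.iterate_succ_apply']⟩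
  · exact ⟨i + 1, le_rfl, (Function.iterate_succ_apply' ..).symm⟩

/-- The initial configuration, but with `v` on the output tape. -/
def outputCfg (M : LogTM) (v : List Bool) : M.Cfg := { M.init with output := v }

open HoseNetwork in
/-- A garden-hose protocol that simulates a space-bounded machine. -/
theorem exists_gardenHoseProtocol (M : LogTM) {S K : ℕ}
    (f : (Fin n → Bool) → (Fin n → Bool) → (Fin K → Bool))
    (hf : ∀ x y, M.HaltsWith (List.ofFn x ++ List.ofFn y) (List.ofFn (f x y)))
    (hS : ∀ x y : Fin n → Bool, M.UsesSpace (List.ofFn x ++ List.ofFn y) S) :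
    let R := (M.boundedCfg (n + n) S K).ncard
    ∃ (P : GardenHoseProtocol n ((2 * R + 2) * (R * (R * 2))))
      (pipe : (Fin K → Bool) ↪ Fin ((2 * R + 2) * (R * (R * 2)))),
      ∀ x y, P.ExitsAtAlice x y (pipe (f x y)) := by
  intro R
  have hfin := finite_boundedCfg (M := M) (n + n) S K
  have : Finite (M.boundedCfg (n + n) S K) := hfin
  have hS0 : 0 < S := hS (fun _ => false) (fun _ => false) M.init .refl
  have houtput {v : List Bool} (hv : v.length ≤ K) : M.outputCfg v ∈ M.boundedCfg (n + n) S K :=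
    ⟨Nat.zero_le _, hS0, fun _ _ => rfl, hv⟩
  let start : M.boundedCfg (n + n) S K := ⟨M.init, houtput (v := []) (Nat.zero_le _)⟩
  classical
  -- The layered program needs total maps on bounded configurations; the default value is never met
  -- on the actual computation.
  let retract (c : M.Cfg) : M.boundedCfg (n + n) S K :=
    if h : c ∈ M.boundedCfg (n + n) S K then ⟨c, h⟩ else start
  have hretract {c : M.Cfg} (h : c ∈ M.boundedCfg (n + n) S K) : (retract c).1 = c := by
    simp [retract, h]
  let gx (x : Fin n → Bool) (_ : ℕ) (c : M.boundedCfg (n + n) S K) := retract (M.aliceStep x c)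
  let gy (y : Fin n → Bool) (t : ℕ) (c : M.boundedCfg (n + n) S K) :=
    -- In the last round Bob resets all but the output, since halting configurations may differ
    -- between inputs with the same value.
    if t = 2 * R + 1 then ⟨M.outputCfg c.1.output, houtput c.2.2.2.2⟩
    else retract (M.bobStep y c)
  obtain ⟨P, pipe, hP⟩ := GardenHoseProtocol.exists_of_layered_fintype R gx gy start
  let code : (Fin K → Bool) ↪ M.boundedCfg (n + n) S K :=
    ⟨fun v => ⟨M.outputCfg (List.ofFn v), houtput (by simp)⟩, fun v w h =>
      List.ofFn_injective (congrArg (fun c => c.1.output) h)⟩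
  refine ⟨P, code.trans pipe, fun x y => ?_⟩
  change P.ExitsAtAlice x y (pipe (code (f x y)))
  suffices code (f x y) = trace (fun b => bif b then gy y else gx x) start (2 * R + 2) by
    rw [this]
    exact hP x y
  let w := List.ofFn x ++ List.ofFn y
  have hmem (i : ℕ) : (M.run w)^[i] M.init ∈ M.boundedCfg (n + n) S K := by
    simpa [w] using iterate_run_mem_boundedCfg (hf x y) (hS x y) i
  obtain ⟨b, hb, hhalt, hout⟩ := hf x y
  have hfix : M.run w b = b := by rw [run, hhalt, Option.getD_none]
  set gs : Bool → ℕ → M.boundedCfg (n + n) S K → M.boundedCfg (n + n) S K :=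
    fun b => bif b then gy y else gx x
  have htrace (j : ℕ) (hj : j ≤ R) :
      ∃ i ≥ j, (trace gs start (2 * j)).1 = (M.run w)^[i] M.init := by
    induction j with
    | zero => exact ⟨0, le_rfl, rfl⟩
    | succ j ih =>
      obtain ⟨i, hi, h⟩ := ih (by omega)
      obtain ⟨i₁, -, h₁⟩ := exists_aliceStep_iterate (M := M) x y i
      obtain ⟨i₂, hi₂, h₂⟩ := exists_bobStep_aliceStep_iterate (M := M) x y i
      refine ⟨i₂, by omega, ?_⟩
      have hne : 2 * j + 1 ≠ 2 * R + 1 := by omega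
      simp only [Nat.mul_succ, trace, gs, gx, gy, Nat.bodd_succ, Nat.bodd_mul, Nat.bodd_zero,
        Bool.not_false, Bool.not_true, Bool.false_and, cond_true, cond_false, hne, if_false, h]
      rw [h₁, hretract (hmem _), ← h₁, h₂, hretract (hmem _)]
  have hstay {i : ℕ} (hi : R ≤ i) : (M.run w)^[i] M.init = b :=
    Function.iterate_card_eq_of_isFixedPt hfin hmem hfix hb.exists_iterate_run hi
  obtain ⟨i, hi, h⟩ := htrace R le_rfl
  obtain ⟨i₁, hi₁, h₁⟩ := exists_aliceStep_iterate (M := M) x y i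
  apply Subtype.ext
  simp only [trace, gs, gx, gy, Nat.bodd_succ, Nat.bodd_mul, Nat.bodd_zero,
    Bool.not_false, Bool.not_true, Bool.false_and, cond_true, cond_false, if_true, h]
  rw [h₁, hretract (hmem _), hstay (hi.trans hi₁), hout]
  rfl

end LogTM

/-! ### The polynomial bound on the number of pipes -/

theorem proposition7 (k : ℕ → ℕ)
    (hk : (fun n => (k n : ℝ)) =O[Filter.atTop] (fun n : ℕ => Real.log n))
    (f : (n : ℕ) → (Fin n → Bool) → (Fin n → Bool) → (Fin (k n) → Bool))
    (hf : LogSpaceComputable k f) :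
    ∃ q : Polynomial ℕ, ∀ n : ℕ, ∃ s : ℕ, s ≤ q.eval n ∧
      ∃ (P : GardenHoseProtocol n s) (pipe : (Fin (k n) → Bool) ↪ Fin s),
        ∀ x y : Fin n → Bool, P.ExitsAtAlice x y (pipe (f n x y)) := by
  obtain ⟨M, s, hs, hM⟩ := hf
  obtain ⟨q₁, hq₁⟩ := exists_polynomial_pow_le hs (Nat.card M.Γ)
  obtain ⟨q₂, hq₂⟩ := exists_polynomial_pow_le hs 2
  obtain ⟨q₃, hq₃⟩ := exists_polynomial_pow_le hk 3
  let q : Polynomial ℕ := Polynomial.C (Nat.card M.Q) *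
    ((2 * Polynomial.X + 2) * (q₁ * (q₂ * (q₃ * 3))))
  refine ⟨(2 * q + 2) * (q * (q * 2)), fun n => ⟨_, ?_, M.exists_gardenHoseProtocol (f n)
    (fun x y => (hM n x y).1) (fun x y => (hM n x y).2)⟩⟩
  have hR : (M.boundedCfg (n + n) (s n) (k n)).ncard ≤ q.eval n := by
    refine (LogTM.ncard_boundedCfg_le _ _ _).trans ?_
    simp only [q, Polynomial.eval_mul, Polynomial.eval_C, Polynomial.eval_add,
      Polynomial.eval_ofNat, Polynomial.eval_X, pow_succ, ← two_mul]
    gcongr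
    exacts [hq₁ n, hq₂ n, hq₃ n]
  simp only [Polynomial.eval_mul, Polynomial.eval_add, Polynomial.eval_ofNat]
  gcongr
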